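/- Let $E$ be a Polish space, let $C_b(E)$ be the bounded continuous real functions on $E$, and let $D_E(\mathbb{R}^+)$ be the Skorokhod space of right-continuous paths $X:\mathbb{R}^+\to E$ with left limits, with its usual (Skorokhod $J_1$) topology and Borel $\sigma$-algebra, and with the filtration $\mathcal{F}_t=\sigma(X(s)\mid s\le t)$. Write $\mathcal{P}=\mathcal{P}(D_E(\mathbb{R}^+))$ for the Borel probability measures on it. Let $A\subseteq C_b(E)\times C_b(E)$ be an operator whose martingale problem is well-posed: for every Borel probability measure $\nu$ on $E$ there is exactly one $\mathbb{P}\in\mathcal{P}$ with $\mathbb{P}\circ X(0)^{-1}=\nu$ such that for all $(f,g)\in A$ the process $f(X(t))-f(X(0))-\int_0^t g(X(s))\,\mathrm{d}s$ is an $(\mathcal{F}_t)$-martingale under $\mathbb{P}$. Let $\mathbb{P}_x$ be the solution with $\nu=\delta_x$, and suppose that $x\mapsto\mathbb{P}_x$ is continuous for the weak topology on $\mathcal{P}$. Let $H$ be the set of all pairs $(f,g)\in C_b(E)\times C_b(E)$ such that for every $x\in E$ the process $$t\mapsto \exp\Big\{f(X(t))-f(X(0))-\int_0^t g(X(s))\,\mathrm{d}s\Big\}$$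 is an $(\mathcal{F}_t)$-martingale under $\mathbb{P}_x$. For $\lambda>0$ and $h\in C_b(E)$ define $$R(\lambda)h(x)=\sup_{\mathbb{Q}\in\mathcal{P}}\int_0^\infty\Big(\int h(X(t))\,\mathbb{Q}(\mathrm{d}X)-S_t(\mathbb{Q}\mid\mathbb{P}_x)\Big)\,\tau_\lambda(\mathrm{d}t),$$ where $S_t(\mathbb{Q}\mid\mathbb{P}_x)\in[0,\infty]$ is the relative entropy of $\mathbb{Q}$ with respect to $\mathbb{P}_x$, both restricted to $\mathcal{F}_t$, and $\tau_\lambda(\mathrm{d}t)=\lambda^{-1}e^{-t/\lambda}\,\mathrm{d}t$ on $\mathbb{R}^+$ is the exponential law with mean $\lambda$. Then for all $\lambda>0$, $x\in E$ and $(f,g)\in H$, $$R(\lambda)(f-\lambda g)(x)=f(x).$$ That is, $R(\lambda)$ is a classical left inverse of $\mathbb{1}-\lambda H$. -/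

import Mathlib

open MeasureTheory ProbabilityTheory Filter Topology
open scoped NNReal ENNReal BoundedContinuousFunction

/-- The space `D_E(ℝ⁺)` of right-continuous trajectories `ℝ⁺ → E` with left limits.
(At `t = 0` the left limit condition is void, as `𝓝[<] 0 = ⊥` in `ℝ≥0`.) -/
structure SkorokhodSpace (E : Type*) [TopologicalSpace E] where
  toFun : ℝ≥0 → E
  rightContinuous : ∀ t, ContinuousWithinAt toFun (Set.Ici t) t
  leftLimits : ∀ t, ∃ l, Tendsto toFun (𝓝[<] t) (𝓝 l)

namespace SkorokhodSpace

section Topology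

variable {E : Type*} [TopologicalSpace E] [PolishSpace E]

instance : CoeFun (SkorokhodSpace E) (fun _ => ℝ≥0 → E) := ⟨toFun⟩

/-- The basic Skorokhod (J1) neighbourhood of `x`: the paths `y` for which some time change `θ`
(a strictly increasing bijection of `ℝ⁺`) satisfies `|θ t - t| ≤ ε` and
`r (y t, x (θ t)) ≤ ε` for all `t ≤ T`, where `r` is a metric for the topology of `E`. The
topology on paths does not depend on the choice of `r`. -/
def basicNhd (x : SkorokhodSpace E) (T : ℝ≥0) (ε : ℝ) : Set (SkorokhodSpace E) :=
  letI : MetricSpace E := TopologicalSpace.metrizableSpaceMetric E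
  {y | ∃ θ : ℝ≥0 ≃o ℝ≥0, ∀ t ≤ T, dist (θ t) t ≤ ε ∧ dist (y t) (x (θ t)) ≤ ε}

theorem basicNhd_mono (x : SkorokhodSpace E) {T T' : ℝ≥0} {ε ε' : ℝ} (hT : T' ≤ T)
    (hε : ε ≤ ε') : basicNhd x T ε ⊆ basicNhd x T' ε' := by
  rintro y ⟨θ, h⟩
  exact ⟨θ, fun t ht => ⟨(h t (ht.trans hT)).1.trans hε, (h t (ht.trans hT)).2.trans hε⟩⟩

/-- The Skorokhod topology on `D_E(ℝ⁺)`: its convergent sequences are those with `x_n → x` iff for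
every `T` there are time changes `θ_n` with `sup_{t ≤ T} |θ_n t - t| → 0` and
`sup_{t ≤ T} r (x_n t, x (θ_n t)) → 0`. -/
instance : TopologicalSpace (SkorokhodSpace E) where
  IsOpen s := ∀ x ∈ s, ∃ T : ℝ≥0, ∃ ε : ℝ, 0 < ε ∧ basicNhd x T ε ⊆ s
  isOpen_univ := fun _ _ => ⟨0, 1, one_pos, Set.subset_univ _⟩
  isOpen_inter := by
    rintro s t hs ht x ⟨hxs, hxt⟩
    obtain ⟨T, ε, hε, h⟩ := hs x hxs
    obtain ⟨T', ε', hε', h'⟩ := ht x hxt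
    exact ⟨max T T', min ε ε', lt_min hε hε', Set.subset_inter
      ((basicNhd_mono x (le_max_left _ _) (min_le_left _ _)).trans h)
      ((basicNhd_mono x (le_max_right _ _) (min_le_right _ _)).trans h')⟩
  isOpen_sUnion := by
    rintro S hS x ⟨s, hsS, hxs⟩
    obtain ⟨T, ε, hε, h⟩ := hS s hsS x hxs
    exact ⟨T, ε, hε, h.trans (Set.subset_sUnion_of_mem hsS)⟩

/-- `D_E(ℝ⁺)` carries the Borel σ-algebra of the Skorokhod topology. -/
instance : MeasurableSpace (SkorokhodSpace E) := borel _

instance : BorelSpace (SkorokhodSpace E) := ⟨rfl⟩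

theorem isOpen_hits {O : Set E} (hO : IsOpen O) (a b : ℝ≥0) :
    IsOpen {X : SkorokhodSpace E | ∃ s, a < s ∧ s < b ∧ X s ∈ O} := by
  let _ : MetricSpace E := TopologicalSpace.metrizableSpaceMetric E
  rintro x ⟨s, has, hsb, hs⟩
  obtain ⟨δ, hδ, hball⟩ := Metric.isOpen_iff.1 hO (x s) hs
  have h1 : (0 : ℝ) < (s : ℝ) - a := sub_pos.2 (by exact_mod_cast has)
  have h2 : (0 : ℝ) < (b : ℝ) - s := sub_pos.2 (by exact_mod_cast hsb)
  obtain ⟨ε, hε, hε'⟩ := exists_between (lt_min hδ (lt_min h1 h2))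
  rw [lt_min_iff, lt_min_iff] at hε'
  refine ⟨b, ε, hε, ?_⟩
  rintro y ⟨θ, hθ⟩
  have htb : θ.symm s < b := by
    by_contra hcon
    have hbs : θ b ≤ s := (θ.le_symm_apply).1 (not_lt.1 hcon)
    have hd := (hθ b le_rfl).1
    rw [NNReal.dist_eq, abs_le] at hd
    have : ((θ b : ℝ≥0) : ℝ) ≤ s := by exact_mod_cast hbs
    linarith [hd.1, hε'.2.2]
  have hd := hθ (θ.symm s) htb.le
  rw [θ.apply_symm_apply] at hd
  have hd1 := hd.1
  rw [NNReal.dist_eq, abs_le] at hd1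
  refine ⟨θ.symm s, ?_, htb, hball (lt_of_le_of_lt hd.2 hε'.1)⟩
  have : (a : ℝ) < (θ.symm s : ℝ≥0) := by linarith [hd1.2, hε'.2.1]
  exact_mod_cast this

variable [MeasurableSpace E] [BorelSpace E]

theorem measurable_eval (t : ℝ≥0) : Measurable (fun X : SkorokhodSpace E => X t) := by
  let _ : MetricSpace E := TopologicalSpace.metrizableSpaceMetric E
  refine measurable_of_isClosed fun C hC => ?_
  rcases C.eq_empty_or_nonempty with rfl | hne
  · simp
  have key : (fun X : SkorokhodSpace E => X t) ⁻¹' C = ⋂ n : ℕ,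
      {X : SkorokhodSpace E | ∃ s, t < s ∧ s < t + 1 / ((n : ℝ≥0) + 1) ∧
        X s ∈ Metric.thickening (1 / ((n : ℝ) + 1)) C} := by
    ext X
    simp only [Set.mem_preimage, Set.mem_iInter, Set.mem_ofPred_eq]
    constructor
    · intro hX n
      have hpos : (0 : ℝ) < 1 / ((n : ℝ) + 1) := by positivity
      have hpos' : (0 : ℝ≥0) < 1 / ((n : ℝ≥0) + 1) := by positivity
      have hc : Tendsto X (𝓝[>] t) (𝓝 (X t)) :=
        (X.rightContinuous t).mono_left (nhdsWithin_mono _ Set.Ioi_subset_Ici_self)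
      have e1 := hc.eventually (Metric.isOpen_thickening.mem_nhds
        (Metric.self_subset_thickening hpos C hX))
      have e2 : ∀ᶠ s in 𝓝[>] t, s ∈ Set.Ioo t (t + 1 / ((n : ℝ≥0) + 1)) :=
        Ioo_mem_nhdsGT (lt_add_of_pos_right t hpos')
      obtain ⟨s, hs1, hs2⟩ := (e1.and e2).exists
      exact ⟨s, hs2.1, hs2.2, hs1⟩
    · intro h
      choose s hs1 hs2 hs3 using h
      have hlim0 : Tendsto (fun n : ℕ => 1 / ((n : ℝ≥0) + 1)) atTop (𝓝 0) :=
        tendsto_one_div_add_atTop_nhds_zero_nat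
      have hlimt : Tendsto (fun n : ℕ => t + 1 / ((n : ℝ≥0) + 1)) atTop (𝓝 t) := by
        simpa using tendsto_const_nhds.add hlim0
      have hs : Tendsto s atTop (𝓝 t) :=
        tendsto_of_tendsto_of_tendsto_of_le_of_le tendsto_const_nhds hlimt
          (fun n => (hs1 n).le) (fun n => (hs2 n).le)
      have hXs : Tendsto (fun n => X (s n)) atTop (𝓝 (X t)) :=
        (X.rightContinuous t).tendsto.comp
          (tendsto_nhdsWithin_iff.2 ⟨hs, Eventually.of_forall fun n => (hs1 n).le⟩)
      have h1 : Tendsto (fun n => Metric.infDist (X (s n)) C) atTop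
          (𝓝 (Metric.infDist (X t) C)) :=
        ((Metric.continuous_infDist_pt C).tendsto _).comp hXs
      have h2 : Tendsto (fun n => Metric.infDist (X (s n)) C) atTop (𝓝 0) := by
        refine squeeze_zero (fun n => Metric.infDist_nonneg) (fun n => ?_)
          (tendsto_one_div_add_atTop_nhds_zero_nat (𝕜 := ℝ))
        obtain ⟨z, hz, hd⟩ := Metric.mem_thickening_iff.1 (hs3 n)
        exact (Metric.infDist_le_dist_of_mem hz).trans hd.le
      exact (hC.mem_iff_infDist_zero hne).2 (tendsto_nhds_unique h1 h2)
  rw [key]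
  exact MeasurableSet.iInter fun n => (isOpen_hits Metric.isOpen_thickening _ _).measurableSet

/-- The filtration `ℱ_t = σ(X(s) | s ≤ t)` on `D_E(ℝ⁺)`. -/
noncomputable def canonicalFiltration (E : Type*) [TopologicalSpace E] [PolishSpace E]
    [MeasurableSpace E] [BorelSpace E] :
    Filtration ℝ≥0 (inferInstance : MeasurableSpace (SkorokhodSpace E)) :=
  Filtration.natural (fun t (X : SkorokhodSpace E) => X t)
    (fun t => (measurable_eval t).stronglyMeasurable)

end Topology

end SkorokhodSpace

section MartingaleProblem

variable {E : Type*} [TopologicalSpace E] [PolishSpace E] [MeasurableSpace E] [BorelSpace E]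

/-- `∫₀ᵗ g(X(s)) ds` -/
noncomputable def pathIntegral (g : E →ᵇ ℝ) (t : ℝ≥0) (X : SkorokhodSpace E) : ℝ :=
  ∫ s in (0 : ℝ)..t, g (X s.toNNReal)

/-- `P` solves the martingale problem for `(A, ν)`. The operator `A` is given by its graph; it
may be multivalued. -/
def SolvesMartingaleProblem (A : Set ((E →ᵇ ℝ) × (E →ᵇ ℝ))) (ν : ProbabilityMeasure E)
    (P : ProbabilityMeasure (SkorokhodSpace E)) : Prop :=
  (P : Measure (SkorokhodSpace E)).map (fun X => X 0) = (ν : Measure E) ∧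
  ∀ fg ∈ A, Martingale (fun t X => fg.1 (X t) - fg.1 (X 0) - pathIntegral fg.2 t X)
    (SkorokhodSpace.canonicalFiltration E) (P : Measure (SkorokhodSpace E))

/-- The martingale problem for `A` is well-posed. -/
def WellPosedMartingaleProblem (A : Set ((E →ᵇ ℝ) × (E →ᵇ ℝ))) : Prop :=
  ∀ ν : ProbabilityMeasure E, ∃! P : ProbabilityMeasure (SkorokhodSpace E),
    SolvesMartingaleProblem A ν P

/-- The martingale problem for `A` is well-posed, `P x` is its solution started at `x`, and
`x ↦ P x` is continuous for the weak topology. -/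
structure IsMarkovFamily (A : Set ((E →ᵇ ℝ) × (E →ᵇ ℝ)))
    (P : E → ProbabilityMeasure (SkorokhodSpace E)) : Prop where
  wellPosed : WellPosedMartingaleProblem A
  solves : ∀ x, SolvesMartingaleProblem A ⟨Measure.dirac x, Measure.dirac.isProbabilityMeasure⟩ (P x)
  continuous : Continuous P

/-- The operator `H` (as a graph): all pairs `(f, g)` for which the exponential process
`exp {f(X(t)) - f(X(0)) - ∫₀ᵗ g(X(s)) ds}` is a martingale under every `P x`. -/
def hamiltonian (P : E → ProbabilityMeasure (SkorokhodSpace E)) :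
    Set ((E →ᵇ ℝ) × (E →ᵇ ℝ)) :=
  {fg | ∀ x, Martingale
    (fun t X => Real.exp (fg.1 (X t) - fg.1 (X 0) - pathIntegral fg.2 t X))
    (SkorokhodSpace.canonicalFiltration E) (P x : Measure (SkorokhodSpace E))}

/-- `S_t(Q | P)`: the relative entropy of the restrictions of `Q` and `P` to `ℱ_t`. -/
noncomputable def entropyUpTo (t : ℝ≥0) (Q P : ProbabilityMeasure (SkorokhodSpace E)) : ℝ≥0∞ :=
  InformationTheory.klDiv
    ((Q : Measure (SkorokhodSpace E)).trim ((SkorokhodSpace.canonicalFiltration E).le t))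
    ((P : Measure (SkorokhodSpace E)).trim ((SkorokhodSpace.canonicalFiltration E).le t))

/-- `τ_lam`: the exponential law with mean `lam` (rate `lam⁻¹`) on `ℝ⁺`. -/
noncomputable def expLaw (lam : ℝ) : Measure ℝ≥0 :=
  (expMeasure lam⁻¹).map Real.toNNReal

/-- `R(lam) h (x) = sup_Q ∫₀^∞ (∫ h(X(t)) Q(dX) - S_t(Q | P x)) τ_lam(dt)`, as an extended real.
The first term of the integrand is bounded and the second one takes values in `[0, ∞]`, so the
outer integral is the difference of a finite real and an element of `[0, ∞]`. -/
noncomputable def nonlinearResolvent (P : E → ProbabilityMeasure (SkorokhodSpace E)) (lam : ℝ)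
    (h : E →ᵇ ℝ) (x : E) : EReal :=
  ⨆ Q : ProbabilityMeasure (SkorokhodSpace E),
    (((∫ t, (∫ X, h (X t) ∂(Q : Measure (SkorokhodSpace E))) ∂(expLaw lam) : ℝ) : EReal)
      - ((∫⁻ t, entropyUpTo t Q (P x) ∂(expLaw lam) : ℝ≥0∞) : EReal))

end MartingaleProblem

/-! Write `u_t = f(X(t)) - f(X(0)) - ∫₀ᵗ g(X(s)) ds`. Fubini against the exponential law gives `∫
(∫₀ᵗ φ) τ_lam(dt) = lam ∫ φ dτ_lam`, so for every law `Q` the reward of `f - lam • g` equals `E_Q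
f(X(0)) + ∫ E_Q u_t τ_lam(dt)` (`integral_meanAt_sub`). It remains to compare `E_Q u_t` with the
entropy `S_t(Q | P x)`.

Upper bound: `exp u_t` has mean one under `P x`, so the Gibbs variational inequality gives `E_Q u_t
≤ S_t`. If the total entropy cost is finite, then `Q` starts at `x` and the first term is `f x`.

Lower bound: equality would hold for a `Q` with density `exp u_t` on every `ℱ_t`. To avoid building
such a law on the infinite horizon, one tilts `P x` by `exp u_T` only. By the martingale property
the density on `ℱ_t` is then `exp u_{min t T}`, and the entropy is exactly `E_Q u_{min t T}`
(`entropyUpTo_tiltedLaw`). The loss comes from times `t > T`, grows at most linearly in `t`, and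
vanishes as `T → ∞`. -/

section ExponentialLaw

/-! ### Integration against the exponential law. -/

theorem integrableOn_mul_exp_neg_mul {r : ℝ} (hr : 0 < r) :
    IntegrableOn (fun t : ℝ => t * Real.exp (-(r * t))) (Set.Ioi 0) := by
  -- A non-integrable function has integral `0` by convention, but this Gamma integral is positive.
  by_contra h
  have h1 := Real.integral_rpow_mul_exp_neg_mul_Ioi (a := 2) (by norm_num) hr
  have h2 : ∫ t : ℝ in Set.Ioi 0, t ^ ((2 : ℝ) - 1) * Real.exp (-(r * t)) = 0 := by
    simpa [show (2 : ℝ) - 1 = 1 by norm_num] using integral_undef h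
  rw [h2] at h1
  have : 0 < (1 / r) ^ (2 : ℝ) * Real.Gamma 2 :=
    mul_pos (by positivity) (Real.Gamma_pos_of_pos (by norm_num))
  linarith

theorem integral_Ioi_mul_exp_neg_mul {r : ℝ} (hr : 0 < r) (a : ℝ) :
    ∫ t in Set.Ioi a, r * Real.exp (-(r * t)) = Real.exp (-(r * a)) := by
  have h := integral_exp_mul_Ioi (a := -r) (by linarith) a
  rw [integral_const_mul]
  simp only [neg_mul] at h
  rw [h]
  field_simp

/-- Integrating by parts against the exponential density. -/
theorem integral_primitive_mul_exp {r : ℝ} (hr : 0 < r) {φ : ℝ → ℝ} (hφ : Measurable φ) {C : ℝ}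
    (hC : ∀ s, |φ s| ≤ C) :
    ∫ t in Set.Ioi (0 : ℝ), (∫ s in (0 : ℝ)..t, φ s) * (r * Real.exp (-(r * t)))
      = ∫ s in Set.Ioi (0 : ℝ), φ s * Real.exp (-(r * s)) := by
  have hC0 : 0 ≤ C := (abs_nonneg _).trans (hC 0)
  set ν : Measure ℝ := volume.restrict (Set.Ioi 0)
  -- Both sides are iterated integrals of this kernel over `0 < s ≤ t`; integrating the density over
  -- `t ≥ s` leaves `exp (-(r * s))`.
  set K : ℝ → ℝ → ℝ := fun t s =>
    (Set.Iic t).indicator (fun s => φ s * (r * Real.exp (-(r * t)))) s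
  have hKm : Measurable (Function.uncurry K) := by
    have : Function.uncurry K = {p : ℝ × ℝ | p.2 ≤ p.1}.indicator
        (fun p => φ p.2 * (r * Real.exp (-(r * p.1)))) := by
      ext ⟨t, s⟩
      simp [K, Set.indicator_apply]
    rw [this]
    exact Measurable.indicator (by fun_prop) (measurableSet_le measurable_snd measurable_fst)
  have hvol : ∀ t : ℝ, ν.restrict (Set.Iic t) = volume.restrict (Set.Ioc 0 t) := fun t => by
    rw [Measure.restrict_restrict measurableSet_Iic, Set.Iic_inter_Ioi]
  have hφi : ∀ t : ℝ, IntegrableOn φ (Set.Ioc 0 t) := fun t =>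
    Integrable.of_bound (hφ.aestronglyMeasurable) C (Eventually.of_forall hC)
  have hKt : ∀ t, Integrable (K t) ν := fun t => by
    rw [integrable_indicator_iff measurableSet_Iic, IntegrableOn, hvol]
    exact (hφi t).mul_const _
  have hKi : Integrable (Function.uncurry K) (ν.prod ν) := by
    rw [integrable_prod_iff hKm.aestronglyMeasurable]
    refine ⟨Eventually.of_forall hKt, ?_⟩
    refine Integrable.mono' (g := fun t => (C * r) * (t * Real.exp (-(r * t))))
      ((integrableOn_mul_exp_neg_mul hr).const_mul _)
      (hKm.stronglyMeasurable.norm.integral_prod_right'.aestronglyMeasurable) ?_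
    refine (ae_restrict_mem measurableSet_Ioi).mono fun t (ht : 0 < t) => ?_
    have hn : (fun s => ‖K t s‖) = (Set.Iic t).indicator
        (fun s => |φ s| * (r * Real.exp (-(r * t)))) := by
      ext s
      simp only [K, Set.indicator_apply]
      split_ifs
      · rw [Real.norm_eq_abs, abs_mul, abs_of_nonneg (a := r * _) (by positivity)]
      · simp
    simp only [Function.uncurry_apply_pair]
    rw [hn, integral_indicator measurableSet_Iic, hvol, integral_mul_const, Real.norm_eq_abs,
      abs_of_nonneg (mul_nonneg (integral_nonneg fun _ => abs_nonneg _) (by positivity))]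
    have h1 : ∫ s in Set.Ioc 0 t, |φ s| ≤ C * t := by
      refine (integral_mono_of_nonneg (g := fun _ => C) (Eventually.of_forall fun _ => abs_nonneg _)
        (integrable_const _) (Eventually.of_forall hC)).trans ?_
      simp [ht.le, mul_comm]
    calc _ ≤ C * t * (r * Real.exp (-(r * t))) := by gcongr
      _ = _ := by ring
  have hswap := integral_integral_swap hKi
  calc _ = ∫ t, ∫ s, K t s ∂ν ∂ν := by
        refine setIntegral_congr_fun measurableSet_Ioi fun t (ht : 0 < t) => ?_
        simp only [K]
        rw [integral_indicator measurableSet_Iic, hvol, integral_mul_const,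
          intervalIntegral.integral_of_le ht.le]
    _ = _ := by
        rw [hswap]
        refine setIntegral_congr_fun measurableSet_Ioi fun s (hs : 0 < s) => ?_
        have : (fun t => K t s) = (Set.Ici s).indicator
            (fun t => φ s * (r * Real.exp (-(r * t)))) := by
          ext t
          simp [K, Set.indicator_apply]
        simp only [this]
        rw [integral_indicator measurableSet_Ici, Measure.restrict_restrict measurableSet_Ici,
          Set.inter_eq_left.2 (Set.Ici_subset_Ioi.2 hs), integral_Ici_eq_integral_Ioi,
          integral_const_mul, integral_Ioi_mul_exp_neg_mul hr]

theorem expMeasure_eq_withDensity (r : ℝ) : expMeasure r = (volume.restrict (Set.Ioi 0)).withDensity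
    (fun s => ENNReal.ofReal (r * Real.exp (-(r * s)))) := by
  rw [← withDensity_indicator measurableSet_Ioi]
  refine withDensity_congr_ae ?_
  -- The two densities may disagree at `0`, which is a null set.
  have h0 : ∀ᵐ s : ℝ, s ≠ 0 := by simp [ae_iff]
  filter_upwards [h0] with s hs
  rcases lt_or_gt_of_ne hs with h | h
  · rw [gammaPDF_of_neg h, Set.indicator_of_notMem (by simpa using h.le)]
  · rw [Set.indicator_of_mem (by simpa using h)]
    exact exponentialPDF_of_nonneg h.le

theorem isProbabilityMeasure_expLaw {lam : ℝ} (hlam : 0 < lam) :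
    IsProbabilityMeasure (expLaw lam) := by
  have := isProbabilityMeasure_expMeasure (inv_pos.2 hlam)
  exact Measure.isProbabilityMeasure_map measurable_real_toNNReal.aemeasurable

theorem integral_expLaw {lam : ℝ} (hlam : 0 < lam) {F : ℝ≥0 → ℝ} (hF : Measurable F) :
    ∫ t, F t ∂(expLaw lam)
      = ∫ s in Set.Ioi (0 : ℝ), F s.toNNReal * (lam⁻¹ * Real.exp (-(lam⁻¹ * s))) := by
  rw [expLaw, integral_map measurable_real_toNNReal.aemeasurable hF.aestronglyMeasurable,
    expMeasure_eq_withDensity, integral_withDensity_eq_integral_toReal_smul (by fun_prop)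
      (by simp)]
  refine integral_congr_ae (Eventually.of_forall fun s => ?_)
  have : 0 ≤ lam⁻¹ * Real.exp (-(lam⁻¹ * s)) := by positivity
  simp only [ENNReal.toReal_ofReal this, smul_eq_mul]
  exact mul_comm _ _

theorem integrable_coe_expLaw {lam : ℝ} (hlam : 0 < lam) :
    Integrable (fun t : ℝ≥0 => (t : ℝ)) (expLaw lam) := by
  rw [expLaw, integrable_map_measure (by fun_prop) measurable_real_toNNReal.aemeasurable,
    expMeasure_eq_withDensity, integrable_withDensity_iff_integrable_smul' (by fun_prop)
      (by simp)]
  refine ((integrableOn_mul_exp_neg_mul (inv_pos.2 hlam)).const_mul lam⁻¹).congr ?_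
  refine (ae_restrict_mem measurableSet_Ioi).mono fun s (hs : 0 < s) => ?_
  have : 0 ≤ lam⁻¹ * Real.exp (-(lam⁻¹ * s)) := by positivity
  simp only [ENNReal.toReal_ofReal this, smul_eq_mul, Function.comp, Real.coe_toNNReal _ hs.le]
  ring

/-- The law `τ_lam` satisfies `∫ (∫₀ᵗ φ) τ_lam(dt) = lam ∫ φ dτ_lam`. -/
theorem integral_primitive_expLaw {lam : ℝ} (hlam : 0 < lam) {φ : ℝ≥0 → ℝ} (hφ : Measurable φ)
    {C : ℝ} (hC : ∀ s, |φ s| ≤ C)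
    (hm : Measurable fun t : ℝ≥0 => ∫ s in (0 : ℝ)..t, φ s.toNNReal) :
    ∫ t : ℝ≥0, (∫ s in (0 : ℝ)..t, φ s.toNNReal) ∂(expLaw lam)
      = lam * ∫ t, φ t ∂(expLaw lam) := by
  rw [integral_expLaw hlam hm, integral_expLaw hlam hφ, ← integral_const_mul]
  have h := integral_primitive_mul_exp (inv_pos.2 hlam) (hφ.comp measurable_real_toNNReal)
    (fun s => hC s.toNNReal)
  calc _ = _ := setIntegral_congr_fun measurableSet_Ioi fun t (ht : 0 < t) => by
        simp only [Real.coe_toNNReal _ ht.le]; rfl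
    _ = _ := h
    _ = _ := by
      refine integral_congr_ae (Eventually.of_forall fun s => ?_)
      simp only [Function.comp]
      field_simp

end ExponentialLaw

/-! ### Relative entropy, exponential tilts and restriction to a sub-σ-algebra. -/

section RelativeEntropy

open InformationTheory

instance isProbabilityMeasure_trim_of_le {Ω : Type*} {m m0 : MeasurableSpace Ω} (hm : m ≤ m0)
    (μ : Measure Ω) [IsProbabilityMeasure μ] : IsProbabilityMeasure (μ.trim hm) :=
  ⟨by rw [trim_measurableSet_eq hm MeasurableSet.univ, measure_univ]⟩

/-- The variational lower bound for the relative entropy. -/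
theorem ofReal_integral_le_klDiv {Ω : Type*} {mΩ : MeasurableSpace Ω} (μ ν : Measure Ω)
    [IsProbabilityMeasure μ] [IsProbabilityMeasure ν] {u : Ω → ℝ} (hu : Integrable u μ)
    (hexp : Integrable (fun x => Real.exp (u x)) ν) (h1 : ∫ x, Real.exp (u x) ∂ν = 1) :
    ENNReal.ofReal (∫ x, u x ∂μ) ≤ klDiv μ ν := by
  by_cases h : μ ≪ ν ∧ Integrable (llr μ ν) μ
  · obtain ⟨hac, hint⟩ := h
    have hprob := isProbabilityMeasure_tilted hexp
    -- The divergence of `μ` from `ν.tilted u` is nonnegative. Its log-normalising constant is `log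
    -- 1 = 0`, so this reads `∫ u ∂μ ≤ ∫ llr μ ν ∂μ`.
    have hgibbs := integral_llr_add_sub_measure_univ_nonneg
      (hac.trans (absolutelyContinuous_tilted hexp))
      (integrable_llr_tilted_right hac hu hint hexp)
    rw [integral_llr_tilted_right hac hu hexp hint, h1] at hgibbs
    rw [klDiv_of_ac_of_integrable hac hint]
    refine ENNReal.ofReal_le_ofReal ?_
    simp at hgibbs ⊢
    exact hgibbs
  · rw [← klDiv_ne_top_iff, not_not] at h
    simp [h]

/-- The relative entropy of an exponential tilt. -/
theorem klDiv_tilted_self {Ω : Type*} {mΩ : MeasurableSpace Ω} (ν : Measure Ω)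
    [IsProbabilityMeasure ν] {u : Ω → ℝ} (hu : Integrable u (ν.tilted u))
    (hexp : Integrable (fun x => Real.exp (u x)) ν) (h1 : ∫ x, Real.exp (u x) ∂ν = 1) :
    klDiv (ν.tilted u) ν = ENNReal.ofReal (∫ x, u x ∂(ν.tilted u)) ∧
      0 ≤ ∫ x, u x ∂(ν.tilted u) := by
  have hprob := isProbabilityMeasure_tilted hexp
  have hac := tilted_absolutelyContinuous ν u
  have hllr : llr (ν.tilted u) ν =ᵐ[ν.tilted u] u := by
    filter_upwards [hac.ae_le (log_rnDeriv_tilted_left_self hexp)] with x hx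
    rw [llr, hx, h1]
    simp
  have hint : Integrable (llr (ν.tilted u) ν) (ν.tilted u) := hu.congr hllr.symm
  have hg := integral_llr_add_sub_measure_univ_nonneg hac hint
  rw [klDiv_of_ac_of_integrable hac hint]
  rw [integral_congr_ae hllr] at hg ⊢
  simp at hg ⊢
  exact hg

theorem integral_trim_exp {Ω : Type*} {m m0 : MeasurableSpace Ω} (hm : m ≤ m0) (ν : Measure Ω)
    {u : Ω → ℝ} (hum : StronglyMeasurable[m] u) :
    ∫ x, Real.exp (u x) ∂(ν.trim hm) = ∫ x, Real.exp (u x) ∂ν :=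
  (integral_trim hm (Real.continuous_exp.comp_stronglyMeasurable hum)).symm

theorem ofReal_integral_le_klDiv_trim {Ω : Type*} {m m0 : MeasurableSpace Ω} (hm : m ≤ m0)
    (μ ν : Measure Ω) [IsProbabilityMeasure μ] [IsProbabilityMeasure ν] {u : Ω → ℝ}
    (hum : StronglyMeasurable[m] u) (hu : Integrable u μ)
    (hexp : Integrable (fun x => Real.exp (u x)) ν) (h1 : ∫ x, Real.exp (u x) ∂ν = 1) :
    ENNReal.ofReal (∫ x, u x ∂μ) ≤ klDiv (μ.trim hm) (ν.trim hm) := by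
  rw [integral_trim hm hum]
  refine ofReal_integral_le_klDiv _ _ (hu.trim hm hum)
    (hexp.trim hm (Real.continuous_exp.comp_stronglyMeasurable hum)) ?_
  rw [integral_trim_exp hm ν hum, h1]

/-- If `exp v` has conditional expectation `exp u` on `m`, then the restriction to `m` of the tilt
by `v` is the tilt by `u`. -/
theorem trim_tilted {Ω : Type*} {m m0 : MeasurableSpace Ω} (hm : m ≤ m0)
    (ν : Measure Ω) [IsProbabilityMeasure ν] {u v : Ω → ℝ}
    (hum : StronglyMeasurable[m] u)
    (h : ∀ s, MeasurableSet[m] s → ∫ x in s, Real.exp (u x) ∂ν = ∫ x in s, Real.exp (v x) ∂ν)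
    (h1 : ∫ x, Real.exp (u x) ∂ν = 1) :
    (ν.tilted v).trim hm = (ν.trim hm).tilted u := by
  have hv1 : ∫ x, Real.exp (v x) ∂ν = 1 := by simpa [h1] using (h Set.univ MeasurableSet.univ).symm
  refine @Measure.ext _ m _ _ fun s hs => ?_
  rw [trim_measurableSet_eq hm hs, tilted_apply_eq_ofReal_integral' _ (hm s hs),
    tilted_apply_eq_ofReal_integral' _ hs, integral_trim_exp hm ν hum, h1, hv1]
  simp only [div_one]
  rw [← h s hs, setIntegral_trim hm (Real.continuous_exp.comp_stronglyMeasurable hum) hs]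

/-- On `m` the tilt by `v` is the tilt by `u`, whose log-density is `u`. Nonnegativity is recorded
because `ENNReal.ofReal` would truncate a negative value. -/
theorem klDiv_trim_tilted {Ω : Type*} {m m0 : MeasurableSpace Ω} (hm : m ≤ m0)
    (ν : Measure Ω) [IsProbabilityMeasure ν] {u v : Ω → ℝ}
    (hum : StronglyMeasurable[m] u) (hu : Integrable u (ν.tilted v))
    (hexp : Integrable (fun x => Real.exp (u x)) ν)
    (h : ∀ s, MeasurableSet[m] s → ∫ x in s, Real.exp (u x) ∂ν = ∫ x in s, Real.exp (v x) ∂ν)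
    (h1 : ∫ x, Real.exp (u x) ∂ν = 1) :
    klDiv ((ν.tilted v).trim hm) (ν.trim hm) = ENNReal.ofReal (∫ x, u x ∂(ν.tilted v)) ∧
      0 ≤ ∫ x, u x ∂(ν.tilted v) := by
  have ht := trim_tilted hm ν hum h h1
  have hu' := hu.trim hm hum
  rw [integral_trim hm hum]
  rw [ht] at hu' ⊢
  exact klDiv_tilted_self _ hu' (hexp.trim hm (Real.continuous_exp.comp_stronglyMeasurable hum))
    (by rw [integral_trim_exp hm ν hum, h1])

end RelativeEntropy

/-! ### Measurability and moments of the exponent along paths. -/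

section Paths

variable {E : Type*} [TopologicalSpace E] [PolishSpace E] [MeasurableSpace E] [BorelSpace E]

/-- Evaluation of a continuous function along a path is jointly measurable in time and path. -/
theorem measurable_uncurry_path (g : E →ᵇ ℝ) :
    Measurable fun p : ℝ≥0 × SkorokhodSpace E => g (p.2 p.1) := by
  -- `r n t` is the point of the grid of mesh `1 / (n + 1)` just after `t`. It takes countably many
  -- values, and right-continuity of paths lets it replace `t` in the limit.
  set r : ℕ → ℝ≥0 → ℝ≥0 := fun n t => ((⌊t * ((n : ℝ≥0) + 1)⌋₊ : ℝ≥0) + 1) / ((n : ℝ≥0) + 1)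
  have hlt : ∀ n t, t ≤ r n t := fun n t => by
    rw [le_div_iff₀ (by positivity)]
    exact (Nat.lt_floor_add_one _).le
  have hle : ∀ n t, r n t ≤ t + 1 / ((n : ℝ≥0) + 1) := fun n t => by
    rw [div_le_iff₀ (by positivity), add_mul, one_div_mul_cancel (by positivity)]
    gcongr
    exact Nat.floor_le (by positivity)
  refine measurable_of_tendsto_metrizable
    (f := fun n (p : ℝ≥0 × SkorokhodSpace E) => g (p.2 (r n p.1))) (fun n => ?_) ?_
  · have h : Measurable fun q : ℕ × SkorokhodSpace E =>
        g (q.2 (((q.1 : ℝ≥0) + 1) / ((n : ℝ≥0) + 1))) :=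
      measurable_from_prod_countable_right fun k =>
        g.continuous.measurable.comp
          (SkorokhodSpace.measurable_eval (((k : ℝ≥0) + 1) / ((n : ℝ≥0) + 1)))
    exact h.comp (((Nat.measurable_floor.comp (measurable_fst.mul_const _))).prodMk measurable_snd)
  · rw [tendsto_pi_nhds]
    rintro ⟨t, X⟩
    have hlimt : Tendsto (fun n : ℕ => t + 1 / ((n : ℝ≥0) + 1)) atTop (𝓝 t) := by
      simpa using tendsto_const_nhds.add
        (tendsto_one_div_add_atTop_nhds_zero_nat (𝕜 := ℝ≥0))
    have hr : Tendsto (fun n => r n t) atTop (𝓝 t) :=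
      tendsto_of_tendsto_of_tendsto_of_le_of_le tendsto_const_nhds hlimt
        (fun n => hlt n t) (fun n => hle n t)
    exact (g.continuous.tendsto _).comp ((X.rightContinuous t).tendsto.comp
      (tendsto_nhdsWithin_iff.2 ⟨hr, Eventually.of_forall fun n => hlt n t⟩))

/-- The mean of `g (X t)`. -/
noncomputable def meanAt (Q : ProbabilityMeasure (SkorokhodSpace E)) (g : E →ᵇ ℝ) (t : ℝ≥0) : ℝ :=
  ∫ X, g (X t) ∂(Q : Measure (SkorokhodSpace E))

/-- The exponent `f(X(t)) - f(X(0)) - ∫₀ᵗ g(X(s)) ds`. -/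
noncomputable def exponent (f g : E →ᵇ ℝ) (t : ℝ≥0) (X : SkorokhodSpace E) : ℝ :=
  f (X t) - f (X 0) - pathIntegral g t X

variable (Q : ProbabilityMeasure (SkorokhodSpace E)) (f g : E →ᵇ ℝ)

theorem measurable_meanAt : Measurable (meanAt Q g) :=
  ((measurable_uncurry_path g).stronglyMeasurable.integral_prod_right').measurable

theorem abs_meanAt_le (t : ℝ≥0) : |meanAt Q g t| ≤ ‖g‖ := by
  have h := norm_integral_le_of_norm_le_const (μ := (Q : Measure (SkorokhodSpace E)))
    (f := fun X => g (X t)) (Eventually.of_forall fun X => g.norm_coe_le_norm (X t))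
  simpa [meanAt] using h

theorem integrable_path (t : ℝ≥0) :
    Integrable (fun X : SkorokhodSpace E => g (X t)) (Q : Measure (SkorokhodSpace E)) :=
  Integrable.of_bound
    (g.continuous.measurable.comp (SkorokhodSpace.measurable_eval t)).aestronglyMeasurable ‖g‖
    (Eventually.of_forall fun X => g.norm_coe_le_norm (X t))

theorem integrable_uncurry_path (t : ℝ≥0) :
    Integrable (fun p : ℝ × SkorokhodSpace E => g (p.2 p.1.toNNReal))
      ((volume.restrict (Set.Ioc 0 (t : ℝ))).prod (Q : Measure (SkorokhodSpace E))) :=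
  Integrable.of_bound ((measurable_uncurry_path g).comp
    ((measurable_real_toNNReal.comp measurable_fst).prodMk measurable_snd)).aestronglyMeasurable ‖g‖
    (Eventually.of_forall fun _ => g.norm_coe_le_norm _)

theorem integrable_pathIntegral (t : ℝ≥0) :
    Integrable (pathIntegral g t) (Q : Measure (SkorokhodSpace E)) := by
  refine (integrable_uncurry_path Q g t).integral_prod_right.congr (Eventually.of_forall fun X => ?_)
  simp only [pathIntegral, intervalIntegral.integral_of_le t.coe_nonneg]

theorem integral_pathIntegral (t : ℝ≥0) :
    ∫ X, pathIntegral g t X ∂(Q : Measure (SkorokhodSpace E))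
      = ∫ s in (0 : ℝ)..t, meanAt Q g s.toNNReal := by
  simp only [pathIntegral, meanAt, intervalIntegral.integral_of_le t.coe_nonneg]
  exact (integral_integral_swap (f := fun (s : ℝ) (X : SkorokhodSpace E) => g (X s.toNNReal))
    (integrable_uncurry_path Q g t)).symm

theorem integrable_exponent (t : ℝ≥0) :
    Integrable (exponent f g t) (Q : Measure (SkorokhodSpace E)) :=
  ((integrable_path Q f t).sub (integrable_path Q f 0)).sub (integrable_pathIntegral Q g t)

theorem integral_exponent (t : ℝ≥0) :
    ∫ X, exponent f g t X ∂(Q : Measure (SkorokhodSpace E))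
      = meanAt Q f t - meanAt Q f 0 - ∫ s in (0 : ℝ)..t, meanAt Q g s.toNNReal := by
  rw [← integral_pathIntegral]
  refine (integral_sub ((integrable_path Q f t).sub (integrable_path Q f 0))
    (integrable_pathIntegral Q g t)).trans ?_
  congr 1
  exact integral_sub (integrable_path Q f t) (integrable_path Q f 0)

theorem continuous_primitive_meanAt :
    Continuous fun t : ℝ≥0 => ∫ s in (0 : ℝ)..t, meanAt Q g s.toNNReal := by
  have : Continuous fun t : ℝ => ∫ s in (0 : ℝ)..t, meanAt Q g s.toNNReal := by
    refine intervalIntegral.continuous_primitive (fun a b => ?_) 0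
    rw [intervalIntegrable_iff, Set.uIoc]
    exact Integrable.of_bound
      ((measurable_meanAt Q g).comp measurable_real_toNNReal).aestronglyMeasurable ‖g‖
      (Eventually.of_forall fun s => abs_meanAt_le Q g _)
  exact this.comp NNReal.continuous_coe

theorem measurable_integral_exponent :
    Measurable fun t => ∫ X, exponent f g t X ∂(Q : Measure (SkorokhodSpace E)) := by
  simp only [integral_exponent]
  exact ((measurable_meanAt Q f).sub_const _).sub (continuous_primitive_meanAt Q g).measurable

/-- Linear growth in `t` suffices both for integrability under `expLaw` and for the truncation error
of the lower bound. -/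
theorem abs_integral_exponent_le (t : ℝ≥0) :
    |∫ X, exponent f g t X ∂(Q : Measure (SkorokhodSpace E))| ≤ 2 * ‖f‖ + ‖g‖ * t := by
  rw [integral_exponent]
  have h : |∫ s in (0 : ℝ)..t, meanAt Q g s.toNNReal| ≤ ‖g‖ * t := by
    have := intervalIntegral.norm_integral_le_of_norm_le_const (a := 0) (b := (t : ℝ))
      (f := fun s => meanAt Q g s.toNNReal) (C := ‖g‖) fun s _ => abs_meanAt_le Q g _
    simpa using this
  have h1 := abs_meanAt_le Q f t
  have h2 := abs_meanAt_le Q f 0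
  rw [abs_le] at *
  constructor <;> linarith

end Paths

/-! ### The two bounds for the resolvent. -/

section Resolvent

variable {E : Type*} [TopologicalSpace E] [PolishSpace E] [MeasurableSpace E] [BorelSpace E]

theorem integrable_integral_exponent {lam : ℝ} (hlam : 0 < lam)
    (Q : ProbabilityMeasure (SkorokhodSpace E)) (f g : E →ᵇ ℝ) :
    Integrable (fun t => ∫ X, exponent f g t X ∂(Q : Measure (SkorokhodSpace E))) (expLaw lam) := by
  have := isProbabilityMeasure_expLaw hlam
  exact Integrable.mono' (g := fun t : ℝ≥0 => 2 * ‖f‖ + ‖g‖ * t)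
    ((integrable_const _).add ((integrable_coe_expLaw hlam).const_mul _))
    (measurable_integral_exponent Q f g).aestronglyMeasurable
    (Eventually.of_forall fun t => abs_integral_exponent_le Q f g t)

theorem integrable_meanAt {lam : ℝ} (hlam : 0 < lam)
    (Q : ProbabilityMeasure (SkorokhodSpace E)) (f : E →ᵇ ℝ) :
    Integrable (meanAt Q f) (expLaw lam) := by
  have := isProbabilityMeasure_expLaw hlam
  exact Integrable.of_bound (measurable_meanAt Q f).aestronglyMeasurable ‖f‖
    (Eventually.of_forall fun t => abs_meanAt_le Q f t)

/-- Averaging the primitive of `meanAt Q g` over `expLaw lam` produces the factor `lam` in front of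
`g`. The identity needs no relation between `Q` and `P`. -/
theorem integral_meanAt_sub {lam : ℝ} (hlam : 0 < lam)
    (Q : ProbabilityMeasure (SkorokhodSpace E)) (f g : E →ᵇ ℝ) :
    ∫ t, (∫ X, (f - lam • g) (X t) ∂(Q : Measure (SkorokhodSpace E))) ∂(expLaw lam)
      = meanAt Q f 0
        + ∫ t, (∫ X, exponent f g t X ∂(Q : Measure (SkorokhodSpace E))) ∂(expLaw lam) := by
  have := isProbabilityMeasure_expLaw hlam
  have hf := integrable_meanAt hlam Q f
  have hg := integrable_meanAt hlam Q g
  have hprim : Integrable (fun t : ℝ≥0 => ∫ s in (0 : ℝ)..t, meanAt Q g s.toNNReal)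
      (expLaw lam) := by
    refine ((hf.sub (integrable_const (meanAt Q f 0))).sub
      (integrable_integral_exponent hlam Q f g)).congr (Eventually.of_forall fun t => ?_)
    simp only [Pi.sub_apply, integral_exponent]
    ring
  have h1 : ∀ t, ∫ X, (f - lam • g) (X t) ∂(Q : Measure (SkorokhodSpace E))
      = meanAt Q f t - lam * meanAt Q g t := fun t => by
    rw [meanAt, meanAt, ← integral_const_mul,
      ← integral_sub (integrable_path Q f t) ((integrable_path Q g t).const_mul _)]
    rfl
  simp only [h1, integral_exponent]
  have h2 : ∫ t, (meanAt Q f t - meanAt Q f 0 - ∫ s in (0 : ℝ)..t, meanAt Q g s.toNNReal)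
        ∂(expLaw lam) = ∫ t, (meanAt Q f t - meanAt Q f 0) ∂(expLaw lam)
        - ∫ t : ℝ≥0, (∫ s in (0 : ℝ)..t, meanAt Q g s.toNNReal) ∂(expLaw lam) :=
    integral_sub (hf.sub (integrable_const _)) hprim
  rw [integral_sub hf (hg.const_mul _), integral_const_mul, h2,
    integral_sub hf (integrable_const _), integral_primitive_expLaw hlam (measurable_meanAt Q g) (abs_meanAt_le Q g)
      (continuous_primitive_meanAt Q g).measurable]
  simp only [integral_const, probReal_univ, one_smul]
  ring

variable {P : E → ProbabilityMeasure (SkorokhodSpace E)} {f g : E →ᵇ ℝ}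

/-- The exponential martingale is adapted, and its logarithm is the exponent. `Nonempty E` supplies
a starting point at which to invoke the martingale. -/
theorem stronglyMeasurable_exponent [Nonempty E] (hfg : (f, g) ∈ hamiltonian P) (t : ℝ≥0) :
    StronglyMeasurable[SkorokhodSpace.canonicalFiltration E t] (exponent f g t) := by
  have h : StronglyMeasurable[SkorokhodSpace.canonicalFiltration E t]
      fun X => Real.exp (exponent f g t X) := (hfg (Classical.arbitrary E)).1 t
  simpa [Function.comp_def] using (Real.measurable_log.comp h.measurable).stronglyMeasurable

theorem integrable_exp_exponent (hfg : (f, g) ∈ hamiltonian P) (x : E) (t : ℝ≥0) :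
    Integrable (fun X => Real.exp (exponent f g t X)) (P x : Measure (SkorokhodSpace E)) :=
  (hfg x).integrable t

theorem setIntegral_exp_exponent (hfg : (f, g) ∈ hamiltonian P) (x : E) {s t : ℝ≥0} (hst : s ≤ t)
    {B : Set (SkorokhodSpace E)} (hB : MeasurableSet[SkorokhodSpace.canonicalFiltration E s] B) :
    ∫ X in B, Real.exp (exponent f g s X) ∂(P x : Measure (SkorokhodSpace E))
      = ∫ X in B, Real.exp (exponent f g t X) ∂(P x : Measure (SkorokhodSpace E)) :=
  (hfg x).setIntegral_eq hst hB

/-- The exponent vanishes at time `0`, and a martingale has constant mean. -/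
theorem integral_exp_exponent (hfg : (f, g) ∈ hamiltonian P) (x : E) (t : ℝ≥0) :
    ∫ X, Real.exp (exponent f g t X) ∂(P x : Measure (SkorokhodSpace E)) = 1 := by
  have h := setIntegral_exp_exponent hfg x (zero_le : 0 ≤ t) MeasurableSet.univ
  simpa [exponent, pathIntegral] using h.symm

theorem ofReal_integral_exponent_le_entropyUpTo (hfg : (f, g) ∈ hamiltonian P) (x : E)
    (Q : ProbabilityMeasure (SkorokhodSpace E)) (t : ℝ≥0) :
    ENNReal.ofReal (∫ X, exponent f g t X ∂(Q : Measure (SkorokhodSpace E)))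
      ≤ entropyUpTo t Q (P x) :=
  have : Nonempty E := ⟨x⟩
  ofReal_integral_le_klDiv_trim _ _ _ (stronglyMeasurable_exponent hfg t)
    (integrable_exponent Q f g t) (integrable_exp_exponent hfg x t) (integral_exp_exponent hfg x t)

/-- A law whose entropy is finite at some time starts where the reference law does. -/
theorem meanAt_zero_of_entropyUpTo_ne_top {Q P₀ : ProbabilityMeasure (SkorokhodSpace E)} {x : E}
    (h0 : (P₀ : Measure (SkorokhodSpace E)).map (fun X => X 0) = Measure.dirac x) {t : ℝ≥0}
    (ht : entropyUpTo t Q P₀ ≠ ∞) (f : E →ᵇ ℝ) : meanAt Q f 0 = f x := by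
  have hac := (InformationTheory.klDiv_ne_top_iff.1 ht).1
  have hx : MeasurableSet ({x}ᶜ : Set E) := (measurableSet_singleton x).compl
  have hB : MeasurableSet[SkorokhodSpace.canonicalFiltration E t]
      {X : SkorokhodSpace E | X 0 ∈ ({x}ᶜ : Set E)} :=
    (((Filtration.stronglyAdapted_natural fun t =>
      (SkorokhodSpace.measurable_eval (E := E) t).stronglyMeasurable) 0).measurable.mono
      ((SkorokhodSpace.canonicalFiltration E).mono zero_le) le_rfl) hx
  have hP0 : (P₀ : Measure (SkorokhodSpace E)) {X : SkorokhodSpace E | X 0 ∈ ({x}ᶜ : Set E)} = 0 := by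
    have := Measure.map_apply (μ := (P₀ : Measure (SkorokhodSpace E)))
      (SkorokhodSpace.measurable_eval (E := E) 0) hx
    rw [h0, Measure.dirac_apply' _ hx] at this
    exact this.symm.trans (by simp)
  have hQ0 := hac ((trim_measurableSet_eq _ hB).trans hP0)
  rw [trim_measurableSet_eq _ hB] at hQ0
  have hae : ∀ᵐ X ∂(Q : Measure (SkorokhodSpace E)), f (X 0) = f x := by
    filter_upwards [compl_mem_ae_iff.2 hQ0] with X hX
    have : X 0 = x := by simpa using hX
    rw [this]
  rw [meanAt, integral_congr_ae hae]
  simp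

theorem nonlinearResolvent_le {lam : ℝ} (hlam : 0 < lam) (hfg : (f, g) ∈ hamiltonian P) {x : E}
    (h0 : (P x : Measure (SkorokhodSpace E)).map (fun X => X 0) = Measure.dirac x) :
    nonlinearResolvent P lam (f - lam • g) x ≤ ((f x : ℝ) : EReal) := by
  have := isProbabilityMeasure_expLaw hlam
  refine iSup_le fun Q => ?_
  rw [integral_meanAt_sub hlam]
  -- An infinite cost makes the value `⊥`. Otherwise the entropy is finite at some time, and any
  -- time will do, since `X 0` is measurable for every `ℱ_t`.
  by_cases htop : ∫⁻ t, entropyUpTo t Q (P x) ∂(expLaw lam) = ∞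
  · simp [htop]
  obtain ⟨t, ht⟩ : ∃ t, entropyUpTo t Q (P x) ≠ ∞ := by
    by_contra! h
    simp [h] at htop
  rw [meanAt_zero_of_entropyUpTo_ne_top h0 ht]
  set ψ := fun t => ∫ X, exponent f g t X ∂(Q : Measure (SkorokhodSpace E))
  have h1 : ∫ t, ψ t ∂(expLaw lam) ≤ (∫⁻ t, entropyUpTo t Q (P x) ∂(expLaw lam)).toReal :=
    -- Dropping the negative part of `ψ` only increases the integral, and the variational bound
    -- controls the positive part.
    calc _ ≤ (∫⁻ t, ENNReal.ofReal (ψ t) ∂(expLaw lam)).toReal := by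
          rw [integral_eq_lintegral_pos_part_sub_lintegral_neg_part
            (integrable_integral_exponent hlam Q f g)]
          exact sub_le_self _ ENNReal.toReal_nonneg
      _ ≤ _ := ENNReal.toReal_mono htop
          (lintegral_mono fun t => ofReal_integral_exponent_le_entropyUpTo hfg x Q t)
  rw [← ENNReal.ofReal_toReal htop, EReal.coe_ennreal_ofReal, max_eq_left ENNReal.toReal_nonneg,
    ← EReal.coe_sub, EReal.coe_le_coe_iff]
  linarith

/-- The law with density `exp {f(X(T)) - f(X(0)) - ∫₀ᵀ g(X(s)) ds}` with respect to `P x`. -/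
noncomputable def tiltedLaw (hfg : (f, g) ∈ hamiltonian P) (x : E) (T : ℝ≥0) :
    ProbabilityMeasure (SkorokhodSpace E) :=
  ⟨(P x : Measure (SkorokhodSpace E)).tilted (exponent f g T),
    isProbabilityMeasure_tilted (integrable_exp_exponent hfg x T)⟩

/-- The density on `ℱ_t` is the exponential at time `min t T`: for `t ≤ T` by the martingale
property, for `t ≥ T` because the density at `T` is already `ℱ_t`-measurable. -/
theorem entropyUpTo_tiltedLaw (hfg : (f, g) ∈ hamiltonian P) (x : E) (t T : ℝ≥0) :
    entropyUpTo t (tiltedLaw hfg x T) (P x) = ENNReal.ofReal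
        (∫ X, exponent f g (min t T) X ∂(tiltedLaw hfg x T : Measure (SkorokhodSpace E))) ∧
      0 ≤ ∫ X, exponent f g (min t T) X ∂(tiltedLaw hfg x T : Measure (SkorokhodSpace E)) := by
  have : Nonempty E := ⟨x⟩
  refine klDiv_trim_tilted _ _
    ((stronglyMeasurable_exponent hfg _).mono
      ((SkorokhodSpace.canonicalFiltration E).mono (min_le_left t T)))
    (integrable_exponent (tiltedLaw hfg x T) f g _) (integrable_exp_exponent hfg x _)
    (fun B hB => ?_) (integral_exp_exponent hfg x _)
  rcases le_total t T with h | h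
  · rw [min_eq_left h]
    exact setIntegral_exp_exponent hfg x h hB
  · rw [min_eq_right h]

theorem sub_integral_indicator_le_nonlinearResolvent {lam : ℝ} (hlam : 0 < lam)
    (hfg : (f, g) ∈ hamiltonian P) {x : E}
    (h0 : (P x : Measure (SkorokhodSpace E)).map (fun X => X 0) = Measure.dirac x) (T : ℝ≥0) :
    ((f x - ∫ t, (Set.Ioi T).indicator (fun t : ℝ≥0 => 4 * ‖f‖ + 2 * (‖g‖ * t)) t ∂(expLaw lam) : ℝ)
      : EReal) ≤ nonlinearResolvent P lam (f - lam • g) x := by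
  have := isProbabilityMeasure_expLaw hlam
  set Q := tiltedLaw hfg x T
  set ψ := fun t => ∫ X, exponent f g t X ∂(Q : Measure (SkorokhodSpace E)) with hψ
  set b := (Set.Ioi T).indicator (fun t : ℝ≥0 => 4 * ‖f‖ + 2 * (‖g‖ * t))
  have hψi : Integrable ψ (expLaw lam) := integrable_integral_exponent hlam Q f g
  have hbi : Integrable b (expLaw lam) :=
    ((integrable_const _).add (((integrable_coe_expLaw hlam).const_mul _).const_mul _)).indicator
      measurableSet_Ioi
  -- For `t > T`, both `|ψ t|` and `|ψ T|` are at most `2 * ‖f‖ + ‖g‖ * t`; `b t` is twice this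
  -- bound.
  have hmin : ∀ t, ψ (min t T) ≤ ψ t + b t := fun t => by
    rcases le_or_gt t T with h | h
    · simp [b, h]
    · have h1 := abs_le.1 (abs_integral_exponent_le Q f g t)
      have h2 := abs_le.1 (abs_integral_exponent_le Q f g T)
      have h3 : ‖g‖ * (T : ℝ) ≤ ‖g‖ * t := by gcongr
      simp only [min_eq_right h.le, b, Set.indicator_of_mem (Set.mem_Ioi.2 h), hψ]
      linarith
  have hS : ∀ t, entropyUpTo t Q (P x) ≤ ENNReal.ofReal (ψ t + b t) := fun t => by
    rw [(entropyUpTo_tiltedLaw hfg x t T).1]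
    exact ENNReal.ofReal_le_ofReal (hmin t)
  have hpos : ∀ t, 0 ≤ ψ t + b t := fun t => (entropyUpTo_tiltedLaw hfg x t T).2.trans (hmin t)
  have hint : ∫⁻ t, entropyUpTo t Q (P x) ∂(expLaw lam)
      ≤ ENNReal.ofReal (∫ t, (ψ t + b t) ∂(expLaw lam)) := by
    rw [ofReal_integral_eq_lintegral_ofReal (f := fun t => ψ t + b t) (hψi.add hbi)
      (Eventually.of_forall hpos)]
    exact lintegral_mono hS
  have hne : entropyUpTo 0 Q (P x) ≠ ∞ := ne_top_of_le_ne_top ENNReal.ofReal_ne_top (hS 0)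
  refine le_iSup_of_le Q ?_
  rw [integral_meanAt_sub hlam, meanAt_zero_of_entropyUpTo_ne_top h0 hne]
  refine le_trans ?_ (EReal.sub_le_sub le_rfl (EReal.coe_ennreal_le_coe_ennreal_iff.2 hint))
  rw [EReal.coe_ennreal_ofReal, max_eq_left (integral_nonneg hpos), ← EReal.coe_sub,
    EReal.coe_le_coe_iff, integral_add hψi hbi]
  linarith

theorem tendsto_integral_indicator_Ioi_natCast {μ : Measure ℝ≥0} {F : ℝ≥0 → ℝ}
    (hF : Integrable F μ) :
    Tendsto (fun n : ℕ => ∫ t, (Set.Ioi (n : ℝ≥0)).indicator F t ∂μ) atTop (𝓝 0) := by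
  have h := tendsto_integral_of_dominated_convergence (μ := μ) (f := fun _ => (0 : ℝ))
    (F := fun (n : ℕ) t => (Set.Ioi (n : ℝ≥0)).indicator F t) (fun t => ‖F t‖)
    (fun n => (hF.indicator measurableSet_Ioi).aestronglyMeasurable) hF.norm
    (fun n => Eventually.of_forall fun t => norm_indicator_le_norm_self F t)
    (Eventually.of_forall fun t => ?_)
  · simpa using h
  · obtain ⟨N, hN⟩ := exists_nat_ge t
    refine tendsto_const_nhds.congr' ?_
    filter_upwards [eventually_ge_atTop N] with n hn
    have : t ≤ n := hN.trans (by exact_mod_cast hn)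
    simp [this]

/-- The laws tilted up to time `n` are near-optimal: their error is a tail integral of a function
integrable under `expLaw lam`, so it tends to `0`. -/
theorem le_nonlinearResolvent {lam : ℝ} (hlam : 0 < lam) (hfg : (f, g) ∈ hamiltonian P) {x : E}
    (h0 : (P x : Measure (SkorokhodSpace E)).map (fun X => X 0) = Measure.dirac x) :
    ((f x : ℝ) : EReal) ≤ nonlinearResolvent P lam (f - lam • g) x := by
  have := isProbabilityMeasure_expLaw hlam
  have hlim := tendsto_integral_indicator_Ioi_natCast (μ := expLaw lam)
    (F := fun t : ℝ≥0 => 4 * ‖f‖ + 2 * (‖g‖ * t))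
    ((integrable_const _).add (((integrable_coe_expLaw hlam).const_mul _).const_mul _))
  have hlim' := (continuous_coe_real_ereal.tendsto _).comp (hlim.const_sub (f x))
  rw [sub_zero] at hlim'
  exact le_of_tendsto hlim' (Eventually.of_forall fun n =>
    sub_integral_indicator_le_nonlinearResolvent hlam hfg h0 n)

end Resolvent

theorem mainTheorem8 {E : Type*} [TopologicalSpace E] [PolishSpace E] [MeasurableSpace E]
    [BorelSpace E] (A : Set ((E →ᵇ ℝ) × (E →ᵇ ℝ)))
    (P : E → ProbabilityMeasure (SkorokhodSpace E)) (hP : IsMarkovFamily A P)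
    (lam : ℝ) (hlam : 0 < lam) (x : E) (f g : E →ᵇ ℝ) (hfg : (f, g) ∈ hamiltonian P) :
    nonlinearResolvent P lam (f - lam • g) x = ((f x : ℝ) : EReal) :=
  le_antisymm (nonlinearResolvent_le hlam hfg (hP.solves x).1)
    (le_nonlinearResolvent hlam hfg (hP.solves x).1)
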